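/- **Setting.** Let $J$ be a finite set of experts, $|J|\ge 2$. Fix a number of tasks $m\ge 1$ and a vector of ground truths $\vec\theta\in\mathbb R^m$. Given $\vec\theta$, the experts' predictions $\vec X_j\in\mathbb R^m$ ($j\in J$) and a reference solution $\vec t\in\mathbb R^m$ are independent; $\vec X_j$ has density $\mathcal Q_j(\cdot|\vec\theta)$. All experts report truthfully, and a deterministic MSE-based competition selects a single expert $j$ minimizing $\|\vec X_j-\vec t\|^2$, with ties broken arbitrarily. The reference solution is either the outcome $\vec Y$, with density $\mathcal Q(\cdot|\vec\theta)$, or an estimate $\vec\theta^s$, with density $\mathcal T(\cdot|\vec\theta)$. All densities are with respect to Lebesgue measure on $\mathbb R^m$, and $\|\cdot\|$ is the Euclidean norm. A density $f$ has the *strict radial monotone likelihood ratio property* (strict RMLRP) with respect to a density $g$ at $\vec c$ if $f(\vec v_1)/g(\vec v_1)>f(\vec v_2)/g(\vec v_2)$ whenever $\|\vec v_1-\vec c\|<\|\vec v_2-\vec c\|$. Assume that 1. each $\mathcal Q_j(\cdot|\vec\theta)$ is everywhere positive and radially symmetric at $\vec\theta$, i.e. of the form $\vec x\mapsto h(\|\vec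 x-\vec\theta\|^2)$ with $h$ measurable; 2. $j^*\in J$ is the best expert: for every $j\ne j^*$, $\mathcal Q_{j^*}(\cdot|\vec\theta)$ has the strict RMLRP with respect to $\mathcal Q_j(\cdot|\vec\theta)$ at $\vec\theta$; 3. $\mathcal T(\cdot|\vec\theta)$ has the strict RMLRP with respect to the outcome's density $\mathcal Q(\cdot|\vec\theta)$ at $\vec\theta$. **Corollary (Efficiency).** (a) Given $\vec\theta$, the best expert $j^*$ wins with strictly higher probability when $\vec t=\vec\theta^s$ than when $\vec t=\vec Y$. (b) Let $\theta_1,\theta_2,\dots$ be a sequence of ground truths such that the setting and assumptions above hold (with the same $J$ and $j^*$) for the first $m$ tasks, for every $m\ge1$. Let $P_{\mathcal T}(m)$ and $P_{Y}(m)$ be the probabilities that $j^*$ wins the competition on the first $m$ tasks when the reference solution is the estimate and the outcome, respectively. For $R\in\{\mathcal T,Y\}$ let $N_R(p)=\min\{m\ge1: P_R(m)\ge p\}\in\mathbb N\cup\{\infty\}$ (where $\min\emptyset=\infty$) be the number of tasks needed to identify the best expert with probability $p$. Then $N_{\mathcal T}(p)\le N_Y(p)$ for every $p\in\mathbb R$.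 Moreover, for every $m\ge1$, $$\max_{1\le k\le m}P_Y(k)<\max_{1\le k\le m}P_{\mathcal T}(k),$$ and for every $p$ with $\max_{1\le k\le m}P_Y(k)<p\le\max_{1\le k\le m}P_{\mathcal T}(k)$ one has $N_{\mathcal T}(p)\le m<N_Y(p)$: scoring against the estimate needs strictly fewer tasks than scoring against the outcomes to reach the identification probability $p$. -/

import Mathlib

open MeasureTheory

noncomputable section

namespace Competition

/-- Vectors over `m` tasks (ground truths, predictions, reference solutions), with the Euclidean
norm. -/
abbrev Vec (m : ℕ) : Type := EuclideanSpace ℝ (Fin m)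

/-- A conditional density `q(v | θ)` on `m` tasks, as a function of the ground truth `θ` and of
the point `v`. -/
abbrev CondDensity (m : ℕ) : Type := Vec m → Vec m → ℝ

/-- `f` is a probability density with respect to Lebesgue measure. -/
structure IsProbDensity {m : ℕ} (f : Vec m → ℝ) : Prop where
  measurable : Measurable f
  nonneg : ∀ v, 0 ≤ f v
  lintegral_eq_one : ∫⁻ v, ENNReal.ofReal (f v) = 1

/-- `f` is radially symmetric at `c`. -/
def IsRadiallySymmetricAt {m : ℕ} (f : Vec m → ℝ) (c : Vec m) : Prop :=
  ∃ h : ℝ → ℝ, Measurable h ∧ ∀ v, f v = h (‖v - c‖ ^ 2)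

/-- The strict radial monotone likelihood ratio property of `f` with respect to `g` at `c`. -/
def StrictRMLRP {m : ℕ} (f g : Vec m → ℝ) (c : Vec m) : Prop :=
  ∀ v₁ v₂ : Vec m, ‖c - v₁‖ ^ 2 < ‖c - v₂‖ ^ 2 → f v₂ / g v₂ < f v₁ / g v₁

/-- Expert `best` is the best expert at ground truth `θ`: the density of its prediction has the
strict RMLRP at `θ` with respect to that of every other expert. -/
def IsBestExpert {J : Type*} {m : ℕ} (Q : J → CondDensity m) (θ : Vec m) (best : J) : Prop :=
  ∀ j, j ≠ best → StrictRMLRP (Q best θ) (Q j θ) θ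

/-- A deterministic MSE-based prediction competition: given the experts' reports and a reference
solution, it selects one expert of least squared error. How ties are broken is arbitrary. -/
structure MSECompetition (J : Type*) (m : ℕ) where
  winner : (J → Vec m) → Vec m → J
  winner_minimizes : ∀ (w : J → Vec m) (t : Vec m) (j : J),
    ‖w (winner w t) - t‖ ^ 2 ≤ ‖w j - t‖ ^ 2

/-- The measure with density `f`. -/
def law {m : ℕ} (f : Vec m → ℝ) : Measure (Vec m) :=
  volume.withDensity fun v => ENNReal.ofReal (f v)

/-- The joint law, given the ground truth `θ`, of all the experts' predictions (expert `j`'s has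
density `Q j θ`) and of the reference solution (with density `R θ`). Given `θ`, they are
independent. -/
def jointLaw {J : Type*} [Fintype J] {m : ℕ} (Q : J → CondDensity m) (R : CondDensity m)
    (θ : Vec m) : Measure ((J → Vec m) × Vec m) :=
  (Measure.pi fun j => law (Q j θ)).prod (law (R θ))

/-- The probability, given the ground truth `θ`, that expert `j` wins the competition `M` when all
the experts report their predictions truthfully and are scored against a reference solution drawn
from `R θ`. -/
def winProb {J : Type*} [Fintype J] {m : ℕ} (M : MSECompetition J m) (Q : J → CondDensity m)
    (R : CondDensity m) (θ : Vec m) (j : J) : ℝ :=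
  (jointLaw Q R θ).real {ω | M.winner ω.1 ω.2 = j}

/-- The assumptions, at ground truth `θ`, on the experts' predictions (densities `Q j`), the
estimator (density `T`) and the outcome (density `QY`). -/
structure Setting {J : Type*} {m : ℕ} (Q : J → CondDensity m) (best : J)
    (T QY : CondDensity m) (θ : Vec m) : Prop where
  expert_density : ∀ j, IsProbDensity (Q j θ)
  full_support : ∀ j x, 0 < Q j θ x
  expert_radial : ∀ j, IsRadiallySymmetricAt (Q j θ) θ
  best_expert : IsBestExpert Q θ best
  estimator_density : IsProbDensity (T θ)
  outcome_density : IsProbDensity (QY θ)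
  estimator_rmlrp : StrictRMLRP (T θ) (QY θ) θ

/-- The vector of the first `m` ground truths of a sequence of tasks. -/
def firstTasks (θ : ℕ → ℝ) (m : ℕ) : Vec m := WithLp.toLp 2 fun i => θ i

/-- The probability that expert `j` wins the competition on the first `m` tasks. -/
def winProbSeq {J : Type*} [Fintype J] (M : ∀ m, MSECompetition J m)
    (Q : ∀ m, J → CondDensity m) (R : ∀ m, CondDensity m) (θ : ℕ → ℝ) (j : J) (m : ℕ) : ℝ :=
  winProb (M m) (Q m) (R m) (firstTasks θ m) j

/-- The number of tasks needed to reach probability `p`, when `P m` is the probability with `m`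
tasks: the least `m ≥ 1` with `p ≤ P m`, and `⊤` if there is none. -/
def tasksNeeded (P : ℕ → ℝ) (p : ℝ) : ℕ∞ :=
  sInf ((fun m : ℕ => (m : ℕ∞)) '' {m | 1 ≤ m ∧ p ≤ P m})

/-- The highest probability among those with `1, …, m` tasks (for `m ≥ 1`). -/
def bestProb (P : ℕ → ℝ) (m : ℕ) : ℝ := sSup (P '' Set.Icc 1 m)

end Competition

end

/-! Let W(t) be the probability that the best expert b is strictly closest to t. Ties are null
events, so b wins with probability ∫ R·W, where R is the density of the reference solution. W
depends only on ‖t - θ‖ (rotational symmetry) and strictly decreases with it (`strictWinProb_lt`). A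
density with the strict RMLRP puts relatively more mass near θ and hence gives W a larger mean
(`integral_mul_lt_of_strictRMLRP`).

For the decrease of W along a ray, take a near and a far point. The difference of the W values is a
sum over rivals k of P(b closest to near, k to far) - P(k closest to near, b to far). Exchanging the
reports of b and k carries one event to the other. On the first event b is closer to θ than k
(`norm_sub_lt_of_closest`), so by RMLRP the joint density is larger there (`real_preimage_swap_lt`).
-/

namespace Competition

open Set

/-! ### Product measures: joint density and null ties. -/

section Pi

variable {J : Type*} [Fintype J]

/-- Gives the predictions a joint density, so that exchanging two reports can be studied pointwise.
On boxes the claim is Fubini for a product of one-variable functions. -/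
theorem pi_withDensity_ofReal {E : Type*} [MeasurableSpace E] {μ : J → Measure E}
    [∀ j, SigmaFinite (μ j)] {f : J → E → ℝ} (hf : ∀ j, Integrable (f j) (μ j))
    (h0 : ∀ j x, 0 ≤ f j x) :
    Measure.pi (fun j => (μ j).withDensity fun x => ENNReal.ofReal (f j x)) =
      (Measure.pi μ).withDensity fun w => ENNReal.ofReal (∏ j, f j (w j)) := by
  have hfin : ∀ j, IsFiniteMeasure ((μ j).withDensity fun x => ENNReal.ofReal (f j x)) :=
    fun j => isFiniteMeasure_withDensity_ofReal (hf j).hasFiniteIntegral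
  refine Measure.pi_eq fun s hs => ?_
  have hind : ∀ j, Integrable ((s j).indicator (f j)) (μ j) := fun j => (hf j).indicator (hs j)
  have h0' : ∀ j x, 0 ≤ (s j).indicator (f j) x := fun j x =>
    Set.indicator_nonneg (fun x _ => h0 j x) x
  rw [withDensity_apply _ (MeasurableSet.univ_pi hs),
    ← lintegral_indicator (MeasurableSet.univ_pi hs)]
  have h1 : ∀ w : J → E, (univ.pi s).indicator (fun w => ENNReal.ofReal (∏ j, f j (w j))) w =
      ENNReal.ofReal (∏ j, (s j).indicator (f j) (w j)) := by
    intro w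
    by_cases hw : w ∈ univ.pi s
    · rw [Set.indicator_of_mem hw]
      congr 1
      exact Finset.prod_congr rfl fun j _ => (Set.indicator_of_mem (hw j (mem_univ j)) _).symm
    · rw [Set.indicator_of_notMem hw]
      obtain ⟨j, hj⟩ : ∃ j, w j ∉ s j := by simpa [Set.mem_pi] using hw
      rw [Finset.prod_eq_zero (Finset.mem_univ j) (Set.indicator_of_notMem hj _),
        ENNReal.ofReal_zero]
  rw [lintegral_congr h1, ← ofReal_integral_eq_lintegral_ofReal
    (Integrable.fintype_prod hind)
    (Filter.Eventually.of_forall fun w => Finset.prod_nonneg fun j _ => h0' j _),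
    integral_fintype_prod_eq_prod, ENNReal.ofReal_prod_of_nonneg
    fun j _ => integral_nonneg (h0' j)]
  refine Finset.prod_congr rfl fun j _ => ?_
  rw [withDensity_apply _ (hs j), ← lintegral_indicator (hs j),
    ofReal_integral_eq_lintegral_ofReal (hind j) (Filter.Eventually.of_forall (h0' j))]
  refine lintegral_congr fun x => ?_
  by_cases hx : x ∈ s j <;> simp [hx]

/-- Two coordinates of a product measure almost surely lie at different distances from a point
whose spheres are null sets. -/
theorem ae_pi_dist_ne {E : Type*} [NormedAddCommGroup E] [MeasurableSpace E] [BorelSpace E]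
    [SecondCountableTopology E] (μ : J → Measure E)
    [∀ j, IsProbabilityMeasure (μ j)] (t : E) (hμ : ∀ j r, μ j (Metric.sphere t r) = 0)
    {j k : J} (hjk : j ≠ k) : ∀ᵐ w ∂Measure.pi μ, ‖w j - t‖ ≠ ‖w k - t‖ := by
  have hind : ProbabilityTheory.IndepFun (fun w : J → E => w j) (fun w => w k) (Measure.pi μ) :=
    (ProbabilityTheory.iIndepFun_pi (X := fun _ x => x)
      (fun i => aemeasurable_id)).indepFun hjk
  have hmap := (ProbabilityTheory.indepFun_iff_map_prod_eq_prod_map_map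
    (measurable_pi_apply j).aemeasurable (measurable_pi_apply k).aemeasurable).1 hind
  have hj : Measure.map (fun w : J → E => w j) (Measure.pi μ) = μ j :=
    (measurePreserving_eval μ j).map_eq
  have hk : Measure.map (fun w : J → E => w k) (Measure.pi μ) = μ k :=
    (measurePreserving_eval μ k).map_eq
  rw [hj, hk] at hmap
  have hS : MeasurableSet {p : E × E | ‖p.1 - t‖ = ‖p.2 - t‖} :=
    measurableSet_eq_fun (by fun_prop) (by fun_prop)
  -- By Fubini: fixing one report confines the other to a sphere around `t`.
  have h0 : ((μ j).prod (μ k)) {p : E × E | ‖p.1 - t‖ = ‖p.2 - t‖} = 0 := by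
    rw [Measure.measure_prod_null hS]
    refine Filter.Eventually.of_forall fun x => ?_
    have : Prod.mk x ⁻¹' {p : E × E | ‖p.1 - t‖ = ‖p.2 - t‖} = Metric.sphere t ‖x - t‖ := by
      ext y
      simp [eq_comm]
    exact (congrArg (μ k) this).trans (hμ k _)
  rw [← hmap, Measure.map_apply (by fun_prop) hS] at h0
  rw [ae_iff]
  simpa only [ne_eq, not_not, preimage_ofPred_eq] using h0

end Pi

/-! ### Events of being strictly closest to a reference point. -/

section Wins

variable {J : Type*} {E : Type*} [NormedAddCommGroup E]

/-- The profiles of reports in which expert `k` is strictly closest to `t`. -/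
def strictWins (k : J) (t : E) : Set (J → E) :=
  {w | ∀ j, j ≠ k → ‖w k - t‖ < ‖w j - t‖}

theorem strictWins_disjoint {j k : J} (h : j ≠ k) (t : E) :
    Disjoint (strictWins j t) (strictWins k t) :=
  Set.disjoint_left.2 fun _ hj hk => lt_asymm (hj k h.symm) (hk j h)

/-- Exchanging reports exchanges the winners at every `t` at once, hence also at two reference
points simultaneously. -/
theorem comp_swap_mem_strictWins [DecidableEq J] (b k i : J) (t : E) (w : J → E) :
    w ∘ Equiv.swap b k ∈ strictWins i t ↔ w ∈ strictWins (Equiv.swap b k i) t := by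
  constructor
  · intro h j hj
    have := h (Equiv.swap b k j) (fun e => hj (by rw [← e, Equiv.swap_apply_self]))
    simpa using this
  · intro h j hj
    exact h _ (fun e => hj ((Equiv.swap b k).injective e))

theorem isOpen_strictWins [Finite J] (k : J) (t : E) : IsOpen (strictWins k t) := by
  have : strictWins k t = ⋂ j, {w : J → E | j ≠ k → ‖w k - t‖ < ‖w j - t‖} := by
    ext w; simp [strictWins]
  rw [this]
  refine isOpen_iInter_of_finite fun j => ?_
  by_cases h : j = k
  · simp [h]
  · simp only [ne_eq, h, not_false_eq_true, forall_true_left]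
    exact isOpen_lt (by fun_prop) (by fun_prop)

theorem exists_mem_strictWins [Finite J] [Nonempty J] {t : E} {w : J → E}
    (h : ∀ j k, j ≠ k → ‖w j - t‖ ≠ ‖w k - t‖) : ∃ k, w ∈ strictWins k t := by
  obtain ⟨k, hk⟩ := Finite.exists_min fun j => ‖w j - t‖
  exact ⟨k, fun j hj => lt_of_le_of_ne (hk j) (h k j hj.symm)⟩

variable [Fintype J] [MeasurableSpace E] [BorelSpace E] [SecondCountableTopology E]

theorem measurableSet_strictWins (k : J) (t : E) : MeasurableSet (strictWins k t) :=
  (isOpen_strictWins k t).measurableSet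

theorem ae_exists_mem_strictWins [Nonempty J] (μ : J → Measure E)
    [∀ j, IsProbabilityMeasure (μ j)] (t : E) (hμ : ∀ j r, μ j (Metric.sphere t r) = 0) :
    ∀ᵐ w ∂Measure.pi μ, ∃ k, w ∈ strictWins k t := by
  have : ∀ᵐ w ∂Measure.pi μ, ∀ j k, j ≠ k → ‖w j - t‖ ≠ ‖w k - t‖ := by
    rw [ae_all_iff]; intro j
    rw [ae_all_iff]; intro k
    by_cases h : j = k
    · simp [h]
    · filter_upwards [ae_pi_dist_ne μ t hμ h] with w hw _ using hw
  filter_upwards [this] with w hw using exists_mem_strictWins hw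

/-- Almost surely exactly one expert is strictly closest to `t`. -/
theorem real_eq_sum_inter_strictWins [Nonempty J] (μ : J → Measure E)
    [∀ j, IsProbabilityMeasure (μ j)] (t : E) (hμ : ∀ j r, μ j (Metric.sphere t r) = 0)
    {A : Set (J → E)} (hA : MeasurableSet A) :
    (Measure.pi μ).real A = ∑ k, (Measure.pi μ).real (A ∩ strictWins k t) := by
  rw [← measureReal_biUnion_finset]
  · refine measureReal_congr ?_
    filter_upwards [ae_exists_mem_strictWins μ t hμ] with w ⟨k, hk⟩
    refine propext ⟨fun h => ?_, fun h => ?_⟩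
    · exact Set.mem_biUnion (Finset.mem_coe.2 (Finset.mem_univ k)) ⟨h, hk⟩
    · have h' : w ∈ ⋃ k ∈ Finset.univ, A ∩ strictWins k t := h
      simp only [Finset.mem_univ, iUnion_true, mem_iUnion, mem_inter_iff] at h'
      exact h'.choose_spec.1
  · intro i _ j _ hij
    exact (strictWins_disjoint hij t).mono inter_subset_right inter_subset_right
  · exact fun k _ => hA.inter (measurableSet_strictWins k t)

end Wins

/-! ### Laws with a density; radial symmetry. -/

section Law

variable {m : ℕ} {f : Vec m → ℝ}

theorem IsProbDensity.integrable (hf : IsProbDensity f) : Integrable f :=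
  (lintegral_ofReal_ne_top_iff_integrable hf.measurable.aestronglyMeasurable
    (Filter.Eventually.of_forall hf.nonneg)).1 (by rw [hf.lintegral_eq_one]; simp)

theorem IsProbDensity.isProbabilityMeasure_law (hf : IsProbDensity f) :
    IsProbabilityMeasure (law f) :=
  ⟨by rw [law, withDensity_apply _ MeasurableSet.univ, Measure.restrict_univ, hf.lintegral_eq_one]⟩

theorem IsProbDensity.integral_eq_one (hf : IsProbDensity f) : ∫ v, f v = 1 := by
  rw [integral_eq_lintegral_of_nonneg_ae (Filter.Eventually.of_forall hf.nonneg)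
    hf.measurable.aestronglyMeasurable, hf.lintegral_eq_one, ENNReal.toReal_one]

theorem nontrivial_vec (hm : 1 ≤ m) : Nontrivial (Vec m) := by
  have : Nonempty (Fin m) := ⟨⟨0, hm⟩⟩
  exact inferInstanceAs (Nontrivial (EuclideanSpace ℝ (Fin m)))

/-- `1 ≤ m` matters: in dimension 0 the sphere of radius 0 is the whole space. -/
theorem law_sphere (hm : 1 ≤ m) (t : Vec m) (r : ℝ) : law f (Metric.sphere t r) = 0 := by
  have := nontrivial_vec hm
  exact withDensity_absolutelyContinuous _ _ (Measure.addHaar_sphere volume t r)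

/-- The law of a radially symmetric density is invariant under isometries fixing the centre. -/
theorem IsRadiallySymmetricAt.measurePreserving {c : Vec m}
    (hr : IsRadiallySymmetricAt f c) (hf : Measurable f) (L : Vec m ≃ₗᵢ[ℝ] Vec m) :
    MeasurePreserving (fun x => c + L (x - c)) (law f) (law f) := by
  have hvol : MeasurePreserving (fun x : Vec m => c + L (x - c)) volume volume :=
    (measurePreserving_add_left volume c).comp
      (L.measurePreserving.comp (measurePreserving_sub_right volume c))
  refine ⟨hvol.measurable, Measure.ext fun s hs => ?_⟩
  obtain ⟨h, -, hfh⟩ := hr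
  rw [Measure.map_apply hvol.measurable hs, law, withDensity_apply _ hs,
    withDensity_apply _ (hvol.measurable hs),
    ← hvol.setLIntegral_comp_preimage hs hf.ennreal_ofReal]
  refine lintegral_congr fun x => ?_
  rw [hfh, hfh, add_sub_cancel_left, L.norm_map]

end Law

/-! ### Exchanging the reports of two experts. -/

section Swap

variable {J : Type*}

theorem measurePreserving_comp_perm [Fintype J] {E : Type*} [MeasurableSpace E] (μ : Measure E)
    [SigmaFinite μ] (σ : Equiv.Perm J) :
    MeasurePreserving (fun w : J → E => w ∘ σ) (Measure.pi fun _ => μ) (Measure.pi fun _ => μ) := by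
  have hm : Measurable fun w : J → E => w ∘ σ :=
    measurable_pi_lambda _ fun j => measurable_pi_apply _
  refine ⟨hm, (Measure.pi_eq fun s hs => ?_).symm⟩
  rw [Measure.map_apply hm (MeasurableSet.univ_pi hs)]
  have : (fun w : J → E => w ∘ σ) ⁻¹' univ.pi s = univ.pi fun j => s (σ.symm j) := by
    ext w
    simp only [mem_preimage, mem_univ_pi, Function.comp_apply]
    exact ⟨fun h j => by simpa using h (σ.symm j), fun h j => by simpa using h (σ j)⟩
  rw [this, Measure.pi_pi]
  exact Equiv.prod_comp σ.symm fun j => μ (s j)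

theorem prod_comp_swap_lt [Fintype J] [DecidableEq J] {E : Type*} {q : J → E → ℝ}
    (hq : ∀ j x, 0 < q j x) {b k : J} (hk : k ≠ b) {w : J → E}
    (h : q b (w k) * q k (w b) < q b (w b) * q k (w k)) :
    ∏ j, q j ((w ∘ Equiv.swap b k) j) < ∏ j, q j (w j) := by
  have hkm : k ∈ Finset.univ.erase b := Finset.mem_erase.2 ⟨hk, Finset.mem_univ k⟩
  rw [← Finset.mul_prod_erase _ _ (Finset.mem_univ b), ← Finset.mul_prod_erase _ _ hkm,
    ← Finset.mul_prod_erase _ (fun j => q j (w j)) (Finset.mem_univ b),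
    ← Finset.mul_prod_erase _ (fun j => q j (w j)) hkm, ← mul_assoc, ← mul_assoc]
  have : ∏ j ∈ (Finset.univ.erase b).erase k, q j ((w ∘ Equiv.swap b k) j) =
      ∏ j ∈ (Finset.univ.erase b).erase k, q j (w j) := by
    refine Finset.prod_congr rfl fun j hj => ?_
    simp only [Finset.mem_erase, Finset.mem_univ, and_true] at hj
    simp [Equiv.swap_apply_of_ne_of_ne hj.2 hj.1]
  rw [this]
  simp only [Function.comp_apply, Equiv.swap_apply_left, Equiv.swap_apply_right]
  exact mul_lt_mul_of_pos_right h (Finset.prod_pos fun j _ => hq j _)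

theorem StrictRMLRP.mul_lt_mul {m : ℕ} {f g : Vec m → ℝ} {c x y : Vec m} (h : StrictRMLRP f g c)
    (hx : 0 < g x) (hy : 0 < g y) (hxy : ‖x - c‖ < ‖y - c‖) : f y * g x < f x * g y := by
  have := h x y (by rw [norm_sub_rev c, norm_sub_rev c]; gcongr)
  rwa [div_lt_div_iff₀ hy hx] at this

/-- Exchanging the reports of the best expert and of another one makes an event less likely, if
the best expert's report is closer to the ground truth on it. -/
theorem real_preimage_swap_lt [Fintype J] [DecidableEq J] {m : ℕ} {q : J → Vec m → ℝ}
    (hd : ∀ j, IsProbDensity (q j)) (hq : ∀ j x, 0 < q j x) {θ : Vec m} {b k : J} (hk : k ≠ b)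
    (hbk : StrictRMLRP (q b) (q k) θ) {A : Set (J → Vec m)} (hA : IsOpen A) (hne : A.Nonempty)
    (hlt : ∀ w ∈ A, ‖w b - θ‖ < ‖w k - θ‖) :
    (Measure.pi fun j => law (q j)).real ((fun w => w ∘ Equiv.swap b k) ⁻¹' A) <
      (Measure.pi fun j => law (q j)).real A := by
  have := fun j => (hd j).isProbabilityMeasure_law
  have hmA := hA.measurableSet
  have hmp := measurePreserving_comp_perm (volume : Measure (Vec m)) (Equiv.swap b k)
  have hdens : (Measure.pi fun j => law (q j)) =
      (Measure.pi fun _ : J => (volume : Measure (Vec m))).withDensity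
        fun w => ENNReal.ofReal (∏ j, q j (w j)) :=
    pi_withDensity_ofReal (fun j => (hd j).integrable) fun j => (hd j).nonneg
  have hmeas : Measurable fun w : J → Vec m => ENNReal.ofReal (∏ j, q j (w j)) :=
    (Finset.measurable_prod _ fun j _ =>
      (hd j).measurable.comp (measurable_pi_apply j)).ennreal_ofReal
  refine (ENNReal.toReal_lt_toReal (measure_ne_top _ _) (measure_ne_top _ _)).2 ?_
  have h1 : (Measure.pi fun j => law (q j)) ((fun w => w ∘ Equiv.swap b k) ⁻¹' A) =
      ∫⁻ w in A, ENNReal.ofReal (∏ j, q j ((w ∘ Equiv.swap b k) j))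
        ∂(Measure.pi fun _ : J => (volume : Measure (Vec m))) := by
    rw [hdens, withDensity_apply _ (hmp.measurable hmA)]
    refine Eq.trans (lintegral_congr fun w => ?_)
      (hmp.setLIntegral_comp_preimage hmA (hmeas.comp hmp.measurable))
    simp
  have hfin : (Measure.pi fun j => law (q j)) ((fun w => w ∘ Equiv.swap b k) ⁻¹' A) ≠ ⊤ :=
    measure_ne_top _ _
  rw [h1] at hfin ⊢
  rw [hdens, withDensity_apply _ hmA]
  -- The integrands compare strictly on all of `A`, which has positive measure, being open and
  -- nonempty.
  refine setLIntegral_strict_mono hmA (hA.measure_pos _ hne).ne' hmeas hfin ?_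
  refine Filter.Eventually.of_forall fun w hw => ?_
  rw [ENNReal.ofReal_lt_ofReal_iff (Finset.prod_pos fun j _ => hq j _)]
  exact prod_comp_swap_lt hq hk (hbk.mul_lt_mul (hq k _) (hq k _) (hlt w hw))

end Swap

/-! ### Geometry of two reference points on a ray from θ. -/

section Ray

variable {E : Type*} [NormedAddCommGroup E] [InnerProductSpace ℝ E]

/-- Moving the reference point away from `θ` along a ray moves the winning report away from `θ`. -/
theorem norm_sub_lt_of_closest {θ v x y : E} {c : ℝ} (hc0 : 0 ≤ c) (hc1 : c < 1)
    (hx : ‖x - (θ + c • v)‖ < ‖y - (θ + c • v)‖) (hy : ‖y - (θ + v)‖ < ‖x - (θ + v)‖) :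
    ‖x - θ‖ < ‖y - θ‖ := by
  have e : ∀ (z : E) (s : ℝ), ‖z - (θ + s • v)‖ ^ 2 =
      ‖z - θ‖ ^ 2 - 2 * (s * inner ℝ (z - θ) v) + s ^ 2 * ‖v‖ ^ 2 := by
    intro z s
    rw [← sub_sub, norm_sub_sq_real, inner_smul_right, norm_smul, mul_pow, Real.norm_eq_abs, sq_abs]
  have h1 := pow_lt_pow_left₀ hx (norm_nonneg _) two_ne_zero
  have h2 := pow_lt_pow_left₀ hy (norm_nonneg _) two_ne_zero
  have e1 := fun z => e z 1
  simp only [one_smul] at e1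
  rw [e, e] at h1
  rw [e1, e1] at h2
  refine lt_of_pow_lt_pow_left₀ 2 (norm_nonneg _) ?_
  have h3 := mul_le_mul_of_nonneg_left h2.le hc0
  nlinarith

theorem strictWins_inter_nonempty {J : Type*} {b k : J} (hk : k ≠ b) {θ v : E} (hv : v ≠ 0)
    {c : ℝ} (hc : c < 1) :
    (strictWins b (θ + c • v) ∩ strictWins k (θ + v)).Nonempty := by
  classical
  have h1 : ∀ s : ℝ, s ≠ c → θ + s • v - (θ + c • v) ≠ 0 := by
    intro s hs
    rw [add_sub_add_left_eq_sub, ← sub_smul]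
    exact smul_ne_zero (sub_ne_zero.2 hs) hv
  have h2 : ∀ s : ℝ, s ≠ 1 → θ + s • v - (θ + v) ≠ 0 := by
    intro s hs
    have : θ + s • v - (θ + v) = (s - 1) • v := by module
    rw [this]
    exact smul_ne_zero (sub_ne_zero.2 hs) hv
  -- `b` reports the near point, `k` the far one, and all others `θ + 2 • v`, which is neither since
  -- `c < 1 < 2`.
  refine ⟨fun j => θ + (if j = b then c else if j = k then 1 else 2) • v, ?_, ?_⟩
  · intro j hj
    simp only [if_true, hj, if_false, sub_self, norm_zero, norm_pos_iff]
    refine h1 _ ?_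
    split_ifs <;> linarith
  · intro j hj
    simp only [hk, if_true, if_false, hj, one_smul, sub_self, norm_zero, norm_pos_iff]
    refine h2 _ ?_
    split_ifs
    · exact hc.ne
    · norm_num

end Ray

/-! ### Monotonicity of the winning probability in the reference point. -/

section WinReal

variable {J : Type*} [Fintype J] {m : ℕ}

/-- The probability that expert `b` is strictly closest to `t`. -/
noncomputable def strictWinProb (q : J → Vec m → ℝ) (b : J) (t : Vec m) : ℝ :=
  (Measure.pi fun j => law (q j)).real (strictWins b t)

theorem strictWinProb_lt_of_ray [Nontrivial J] (hm : 1 ≤ m) {q : J → Vec m → ℝ}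
    (hd : ∀ j, IsProbDensity (q j)) (hq : ∀ j x, 0 < q j x) {θ : Vec m} {b : J}
    (hb : ∀ k, k ≠ b → StrictRMLRP (q b) (q k) θ) {v : Vec m} (hv : v ≠ 0) {c : ℝ} (hc0 : 0 ≤ c)
    (hc1 : c < 1) : strictWinProb q b (θ + v) < strictWinProb q b (θ + c • v) := by
  classical
  have := fun j => (hd j).isProbabilityMeasure_law
  -- Each event is split by who is closest to the other reference point; the terms where `b` is
  -- closest to both then agree.
  rw [strictWinProb, strictWinProb,
    real_eq_sum_inter_strictWins _ (θ + c • v) (fun j r => law_sphere hm _ r)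
      (measurableSet_strictWins b (θ + v)),
    real_eq_sum_inter_strictWins _ (θ + v) (fun j r => law_sphere hm _ r)
      (measurableSet_strictWins b (θ + c • v))]
  have key : ∀ k, k ≠ b →
      (Measure.pi fun j => law (q j)).real (strictWins b (θ + v) ∩ strictWins k (θ + c • v)) <
      (Measure.pi fun j => law (q j)).real
        (strictWins b (θ + c • v) ∩ strictWins k (θ + v)) := by
    intro k hk
    have h := real_preimage_swap_lt hd hq hk (hb k hk)
      ((isOpen_strictWins b (θ + c • v)).inter (isOpen_strictWins k (θ + v)))
      (strictWins_inter_nonempty hk hv hc1)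
      (fun w hw => norm_sub_lt_of_closest hc0 hc1 (hw.1 k hk) (hw.2 b hk.symm))
    refine lt_of_eq_of_lt (congrArg _ ?_) h
    ext w
    simp only [mem_inter_iff, mem_preimage, comp_swap_mem_strictWins, Equiv.swap_apply_left,
      Equiv.swap_apply_right]
    exact and_comm
  obtain ⟨k, hk⟩ := exists_ne b
  refine Finset.sum_lt_sum (fun j _ => ?_) ⟨k, Finset.mem_univ k, key k hk⟩
  by_cases hj : j = b
  · rw [hj, inter_comm]
  · exact (key j hj).le

/-- A reflection fixing `θ` carries `t` to `t'` and preserves every expert's law. -/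
theorem strictWinProb_eq_of_norm_eq {q : J → Vec m → ℝ} (hd : ∀ j, IsProbDensity (q j))
    {θ : Vec m} (hr : ∀ j, IsRadiallySymmetricAt (q j) θ) (b : J) {t t' : Vec m}
    (h : ‖t - θ‖ = ‖t' - θ‖) : strictWinProb q b t = strictWinProb q b t' := by
  have := fun j => (hd j).isProbabilityMeasure_law
  set L := (ℝ ∙ ((t - θ) - (t' - θ)))ᗮ.reflection
  have hL : L (t - θ) = t' - θ := Submodule.reflection_sub h
  have hmp := measurePreserving_pi (fun j => law (q j)) (fun j => law (q j))
    fun j => (hr j).measurePreserving (hd j).measurable L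
  rw [strictWinProb, strictWinProb,
    ← hmp.measureReal_preimage (measurableSet_strictWins b t').nullMeasurableSet]
  congr 1
  have e : ∀ x : Vec m, ‖θ + L (x - θ) - t'‖ = ‖x - t‖ := by
    intro x
    have : θ + L (x - θ) - t' = L (x - t) := by
      have h2 : x - t = (x - θ) - (t - θ) := by abel
      rw [h2, map_sub L (x - θ) (t - θ), hL]
      abel
    rw [this, L.norm_map]
  ext w
  simp only [strictWins, mem_preimage, mem_ofPred_eq, e]

/-- The probability that the best expert is closest to the reference point strictly decreases with
the distance from that point to the ground truth. -/
theorem strictWinProb_lt [Nontrivial J] (hm : 1 ≤ m) {q : J → Vec m → ℝ}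
    (hd : ∀ j, IsProbDensity (q j)) (hq : ∀ j x, 0 < q j x) {θ : Vec m}
    (hr : ∀ j, IsRadiallySymmetricAt (q j) θ) {b : J}
    (hb : ∀ k, k ≠ b → StrictRMLRP (q b) (q k) θ) {t t' : Vec m} (h : ‖t - θ‖ < ‖t' - θ‖) :
    strictWinProb q b t' < strictWinProb q b t := by
  have hpos : 0 < ‖t' - θ‖ := (norm_nonneg _).trans_lt h
  -- The ratio of the distances scales `t' - θ` to a point as far from `θ` as `t`.
  have hlt := strictWinProb_lt_of_ray hm hd hq hb (norm_pos_iff.1 hpos)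
    (div_nonneg (norm_nonneg (t - θ)) hpos.le) ((div_lt_one hpos).2 h)
  rw [add_sub_cancel] at hlt
  refine hlt.trans_eq (strictWinProb_eq_of_norm_eq hd hr b ?_)
  rw [add_sub_cancel_left, norm_smul, Real.norm_eq_abs, abs_of_nonneg (by positivity),
    div_mul_cancel₀ _ hpos.ne']

end WinReal

/-! ### Averaging over the reference solution. -/

section Mixture

variable {J : Type*} [Fintype J] {m : ℕ}

theorem measurableSet_setOf_mem_strictWins (b : J) :
    MeasurableSet {p : (J → Vec m) × Vec m | p.1 ∈ strictWins b p.2} := by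
  have : {p : (J → Vec m) × Vec m | p.1 ∈ strictWins b p.2} =
      ⋂ j, {p | j ≠ b → ‖p.1 b - p.2‖ < ‖p.1 j - p.2‖} := by
    ext p; simp [strictWins]
  rw [this]
  refine MeasurableSet.iInter fun j => ?_
  by_cases h : j = b
  · simp [h]
  · simp only [ne_eq, h, not_false_eq_true, forall_true_left]
    exact measurableSet_lt (by fun_prop) (by fun_prop)

theorem measurable_strictWinProb {q : J → Vec m → ℝ} (hd : ∀ j, IsProbDensity (q j)) (b : J) :
    Measurable (strictWinProb q b) := by
  have := fun j => (hd j).isProbabilityMeasure_law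
  exact (measurable_measure_prodMk_right (measurableSet_setOf_mem_strictWins b)).ennreal_toReal

/-- Ties being null events, the winning probability is that of being strictly closest. -/
theorem winProb_eq_integral [Nonempty J] (hm : 1 ≤ m) (M : MSECompetition J m)
    {Q : J → CondDensity m} {R : CondDensity m} {θ : Vec m} (hd : ∀ j, IsProbDensity (Q j θ))
    (hR : IsProbDensity (R θ)) (b : J) :
    winProb M Q R θ b = ∫ t, R θ t * strictWinProb (fun j => Q j θ) b t := by
  have := fun j => (hd j).isProbabilityMeasure_law
  have := hR.isProbabilityMeasure_law
  have hA := measurableSet_setOf_mem_strictWins (J := J) (m := m) b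
  have hA' : MeasurableSet {p : (J → Vec m) × Vec m | ∀ j, ‖p.1 b - p.2‖ ≤ ‖p.1 j - p.2‖} := by
    rw [ofPred_forall]
    exact MeasurableSet.iInter fun j => measurableSet_le (by fun_prop) (by fun_prop)
  have heq : jointLaw Q R θ {p | ∀ j, ‖p.1 b - p.2‖ ≤ ‖p.1 j - p.2‖} =
      jointLaw Q R θ {p | p.1 ∈ strictWins b p.2} := by
    rw [jointLaw, Measure.prod_apply_symm hA, Measure.prod_apply_symm hA']
    refine lintegral_congr fun t => measure_congr ?_
    filter_upwards [ae_exists_mem_strictWins (fun j => law (Q j θ)) t fun j r => law_sphere hm t r]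
      with w ⟨k, hk⟩
    refine propext ⟨fun h => ?_, fun h j => ?_⟩
    · by_cases hkb : b = k
      · rw [← hkb] at hk; exact hk
      · exact absurd (hk b hkb) (not_lt.2 (h k))
    · by_cases hj : j = b
      · rw [hj]
      · exact (h j hj).le
  -- The winning set need not be measurable, as tie-breaking is arbitrary; it is squeezed between
  -- the strict and weak events, which have equal measure.
  have hwin : winProb M Q R θ b = (jointLaw Q R θ).real {p | p.1 ∈ strictWins b p.2} := by
    have : IsProbabilityMeasure (jointLaw Q R θ) := by unfold jointLaw; infer_instance
    refine le_antisymm ?_ (measureReal_mono fun p hp => ?_)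
    · rw [measureReal_def, ← heq]
      refine measureReal_mono fun p hp j => ?_
      have h := M.winner_minimizes p.1 p.2 j
      rw [show M.winner p.1 p.2 = b from hp] at h
      exact le_of_sq_le_sq h (norm_nonneg _)
    · by_contra hne
      have h := hp _ hne
      exact absurd (M.winner_minimizes p.1 p.2 b)
        (not_le.2 (pow_lt_pow_left₀ h (norm_nonneg _) two_ne_zero))
  rw [hwin, measureReal_def, jointLaw, Measure.prod_apply_symm hA, ← integral_toReal
    (measurable_measure_prodMk_right hA).aemeasurable
    (Filter.Eventually.of_forall fun t => measure_lt_top _ _), law,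
    integral_withDensity_eq_integral_toReal_smul hR.measurable.ennreal_ofReal
      (Filter.Eventually.of_forall fun t => ENNReal.ofReal_lt_top)]
  refine integral_congr_ae (Filter.Eventually.of_forall fun t => ?_)
  simp only [ENNReal.toReal_ofReal (hR.nonneg t), smul_eq_mul]
  rfl

/-- Since `x / 0 = 0`, a zero of `g` would give ratio 0 there, yet this must exceed a nonnegative
ratio at some farther point. -/
theorem StrictRMLRP.pos_right (hm : 1 ≤ m) {f g : Vec m → ℝ} {c : Vec m}
    (hf : ∀ v, 0 ≤ f v) (hg : ∀ v, 0 ≤ g v) (h : StrictRMLRP f g c) (v : Vec m) : 0 < g v := by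
  have := nontrivial_vec hm
  obtain ⟨u, hu⟩ := NormedSpace.exists_lt_norm ℝ (Vec m) ‖c - v‖
  have := h v (c - u) (by rw [sub_sub_cancel]; gcongr)
  refine lt_of_le_of_ne (hg v) fun h0 => ?_
  rw [← h0, div_zero] at this
  exact absurd this (not_lt.2 (div_nonneg (hf _) (hg _)))

/-- A bounded function that decreases strictly with the distance to `c` has a greater mean under
a density that has the strict RMLRP at `c`. -/
theorem integral_mul_lt_of_strictRMLRP (hm : 1 ≤ m) {f g W : Vec m → ℝ} {c : Vec m} {C : ℝ}
    (hf : IsProbDensity f) (hg : IsProbDensity g) (h : StrictRMLRP f g c) (hW : Measurable W)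
    (hbd : ∀ t, ‖W t‖ ≤ C) (heq : ∀ s t, ‖s - c‖ = ‖t - c‖ → W s = W t)
    (hlt : ∀ s t, ‖s - c‖ < ‖t - c‖ → W t < W s) :
    ∫ t, g t * W t < ∫ t, f t * W t := by
  have hgpos := h.pos_right hm hf.nonneg hg.nonneg
  have hfW : Integrable fun t => f t * W t :=
    hf.integrable.mul_bdd hW.aestronglyMeasurable (Filter.Eventually.of_forall hbd)
  have hgW : Integrable fun t => g t * W t :=
    hg.integrable.mul_bdd hW.aestronglyMeasurable (Filter.Eventually.of_forall hbd)
  have i1 := hfW.mul_prod hg.integrable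
  have i2 := hgW.mul_prod hf.integrable
  have i3 := hf.integrable.mul_prod hgW
  have i4 := hg.integrable.mul_prod hfW
  have hpos : ∀ s t, ‖s - c‖ < ‖t - c‖ → 0 < (W s - W t) * (f s * g t - f t * g s) :=
    fun s t hst => mul_pos (sub_pos.2 (hlt s t hst))
      (sub_pos.2 (h.mul_lt_mul (hgpos s) (hgpos t) hst))
  -- Both factors change sign when the two points are exchanged, so the product is nonnegative. As
  -- `f` and `g` have mass 1, it integrates to twice the desired difference.
  have hF : ∀ p : Vec m × Vec m,
      (W p.1 - W p.2) * (f p.1 * g p.2 - f p.2 * g p.1) =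
      f p.1 * W p.1 * g p.2 - g p.1 * W p.1 * f p.2 - f p.1 * (g p.2 * W p.2) +
        g p.1 * (f p.2 * W p.2) := fun p => by ring
  have hFi : Integrable (fun p : Vec m × Vec m =>
      (W p.1 - W p.2) * (f p.1 * g p.2 - f p.2 * g p.1)) (volume.prod volume) := by
    simp only [hF]
    exact ((i1.sub i2).sub i3).add i4
  have hnn : ∀ p : Vec m × Vec m, 0 ≤ (W p.1 - W p.2) * (f p.1 * g p.2 - f p.2 * g p.1) := by
    rintro ⟨s, t⟩
    rcases lt_trichotomy ‖s - c‖ ‖t - c‖ with hst | hst | hst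
    · exact (hpos s t hst).le
    · simp [heq s t hst]
    · have := hpos t s hst
      dsimp only
      linarith
  have hint : 0 < ∫ p : Vec m × Vec m,
      (W p.1 - W p.2) * (f p.1 * g p.2 - f p.2 * g p.1) ∂(volume.prod volume) := by
    rw [integral_pos_iff_support_of_nonneg hnn hFi]
    have hU : IsOpen {p : Vec m × Vec m | ‖p.1 - c‖ < ‖p.2 - c‖} :=
      isOpen_lt (by fun_prop) (by fun_prop)
    have := nontrivial_vec hm
    obtain ⟨u, hu⟩ := exists_ne (0 : Vec m)
    refine (hU.measure_pos (volume.prod volume) ⟨(c, c + u), ?_⟩).trans_le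
      (measure_mono fun p hp => (hpos p.1 p.2 hp).ne')
    simpa using hu
  simp only [hF] at hint
  have i12 := i1.sub i2
  have i123 := i12.sub i3
  simp only [Pi.sub_def] at i12 i123
  rw [integral_add i123 i4, integral_sub i12 i3, integral_sub i1 i2,
    integral_prod_mul (fun t => f t * W t) g, integral_prod_mul (fun t => g t * W t) f,
    integral_prod_mul f fun t => g t * W t, integral_prod_mul g fun t => f t * W t,
    hf.integral_eq_one, hg.integral_eq_one] at hint
  linarith

theorem winProb_lt_winProb [Nontrivial J] (hm : 1 ≤ m) (M : MSECompetition J m)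
    {Q : J → CondDensity m} {T QY : CondDensity m} {best : J} {θ : Vec m}
    (hS : Setting Q best T QY θ) : winProb M Q QY θ best < winProb M Q T θ best := by
  have := fun j => (hS.expert_density j).isProbabilityMeasure_law
  rw [winProb_eq_integral hm M hS.expert_density hS.outcome_density,
    winProb_eq_integral hm M hS.expert_density hS.estimator_density]
  refine integral_mul_lt_of_strictRMLRP hm (C := 1) hS.estimator_density hS.outcome_density
    hS.estimator_rmlrp (measurable_strictWinProb hS.expert_density best) (fun t => ?_)
    (fun s t => strictWinProb_eq_of_norm_eq hS.expert_density hS.expert_radial best)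
    (fun s t => strictWinProb_lt hm hS.expert_density hS.full_support hS.expert_radial
      hS.best_expert)
  rw [strictWinProb, Real.norm_eq_abs, abs_of_nonneg measureReal_nonneg]
  exact measureReal_le_one

end Mixture

/-! ### Numbers of tasks; no monotonicity of `P` in `m` is assumed, hence the running maxima. -/

section Tasks

variable {P P' : ℕ → ℝ}

theorem tasksNeeded_le_tasksNeeded (h : ∀ m, 1 ≤ m → P m ≤ P' m) (p : ℝ) :
    tasksNeeded P' p ≤ tasksNeeded P p :=
  sInf_le_sInf (image_mono fun m hm => ⟨hm.1, hm.2.trans (h m hm.1)⟩)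

theorem exists_eq_bestProb (P : ℕ → ℝ) {m : ℕ} (hm : 1 ≤ m) :
    ∃ k, 1 ≤ k ∧ k ≤ m ∧ P k = bestProb P m := by
  obtain ⟨k, hk, h⟩ := ((nonempty_Icc.2 hm).image P).csSup_mem ((finite_Icc 1 m).image P)
  exact ⟨k, hk.1, hk.2, h⟩

theorem le_bestProb (P : ℕ → ℝ) {k m : ℕ} (hk : 1 ≤ k) (hkm : k ≤ m) : P k ≤ bestProb P m :=
  le_csSup ((finite_Icc 1 m).image P).bddAbove (mem_image_of_mem P ⟨hk, hkm⟩)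

theorem bestProb_lt_bestProb (h : ∀ m, 1 ≤ m → P m < P' m) {m : ℕ} (hm : 1 ≤ m) :
    bestProb P m < bestProb P' m := by
  obtain ⟨k, hk, hkm, hP⟩ := exists_eq_bestProb P hm
  exact hP ▸ (h k hk).trans_le (le_bestProb P' hk hkm)

theorem tasksNeeded_le_of_le_bestProb {m : ℕ} (hm : 1 ≤ m) {p : ℝ} (hp : p ≤ bestProb P m) :
    tasksNeeded P p ≤ m := by
  obtain ⟨k, hk, hkm, hP⟩ := exists_eq_bestProb P hm
  have hle : tasksNeeded P p ≤ k := sInf_le ⟨k, ⟨hk, hp.trans_eq hP.symm⟩, rfl⟩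
  exact hle.trans (Nat.cast_le.2 hkm)

theorem lt_tasksNeeded_of_bestProb_lt {m : ℕ} {p : ℝ} (hp : bestProb P m < p) :
    (m : ℕ∞) < tasksNeeded P p := by
  -- Bounding the infimum by `m + 1` yields strictness, also when the infimum is `⊤`.
  have : ((m + 1 : ℕ) : ℕ∞) ≤ tasksNeeded P p := by
    refine le_sInf ?_
    rintro _ ⟨k, ⟨hk, hpk⟩, rfl⟩
    refine Nat.cast_le.2 (Nat.succ_le_of_lt (lt_of_not_ge fun hkm => ?_))
    exact absurd (hp.trans_le hpk) (not_lt.2 (le_bestProb P hk hkm))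
  exact (Nat.cast_lt.2 m.lt_succ_self).trans_le this

end Tasks

end Competition

theorem mainTheorem3 {J : Type*} [Fintype J] [Nontrivial J] (best : J)
    (M : ∀ m : ℕ, Competition.MSECompetition J m)
    (Q : ∀ m : ℕ, J → Competition.CondDensity m)
    (T QY : ∀ m : ℕ, Competition.CondDensity m) :
    -- for any number of tasks, the estimate identifies the best expert with higher probability
    (∀ m : ℕ, 1 ≤ m → ∀ θ : Competition.Vec m,
      Competition.Setting (Q m) best (T m) (QY m) θ →
        Competition.winProb (M m) (Q m) (QY m) θ best
          < Competition.winProb (M m) (Q m) (T m) θ best) ∧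
    -- number of tasks needed to identify the best expert with a given probability
    (∀ θ : ℕ → ℝ,
      (∀ m : ℕ, 1 ≤ m →
        Competition.Setting (Q m) best (T m) (QY m) (Competition.firstTasks θ m)) →
      -- never more tasks with the estimate than with the outcome
      (∀ p : ℝ,
        Competition.tasksNeeded (Competition.winProbSeq M Q T θ best) p
          ≤ Competition.tasksNeeded (Competition.winProbSeq M Q QY θ best) p) ∧
      -- for every `m`, a nondegenerate interval of probabilities for which `m` tasks are enough
      -- with the estimate while strictly more than `m` are needed with the outcome
      (∀ m : ℕ, 1 ≤ m →
        Competition.bestProb (Competition.winProbSeq M Q QY θ best) m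
            < Competition.bestProb (Competition.winProbSeq M Q T θ best) m ∧
        ∀ p : ℝ, Competition.bestProb (Competition.winProbSeq M Q QY θ best) m < p →
          p ≤ Competition.bestProb (Competition.winProbSeq M Q T θ best) m →
            Competition.tasksNeeded (Competition.winProbSeq M Q T θ best) p ≤ (m : ℕ∞) ∧
            (m : ℕ∞) < Competition.tasksNeeded (Competition.winProbSeq M Q QY θ best) p)) := by
  refine ⟨fun m hm θ hS => Competition.winProb_lt_winProb hm (M m) hS, fun θ hS => ?_⟩
  have hlt : ∀ m, 1 ≤ m → Competition.winProbSeq M Q QY θ best m <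
      Competition.winProbSeq M Q T θ best m :=
    fun m hm => Competition.winProb_lt_winProb hm (M m) (hS m hm)
  exact ⟨Competition.tasksNeeded_le_tasksNeeded fun m hm => (hlt m hm).le,
    fun m hm => ⟨Competition.bestProb_lt_bestProb hlt hm, fun p hp hp' =>
      ⟨Competition.tasksNeeded_le_of_le_bestProb hm hp',
        Competition.lt_tasksNeeded_of_bestProb_lt hp⟩⟩⟩
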